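/- Let $G$ be a finite simple graph with $n \ge 9$ vertices and $e$ edges, minimum degree $\delta$ and maximum degree $\Delta$, and let $M_1(G) = \sum_{u \in V(G)} d_G(u)^2$ be its first Zagreb index, where $d_G(u)$ is the degree of $u$. Let $k \ge 1$ and suppose that $G$ is $k$-connected, i.e. $n > k$ and deleting any set of fewer than $k$ vertices leaves a connected graph. If $$M_1(G) \ge (n-k-2)\,\Delta^2 + \frac{\bigl(e(\delta+n-k-2)\bigr)^2}{4\,\delta\,(n-k-2)(k+2)}$$ (where, in the degenerate case $k = n-2$, the fraction is read as $0$), then $G$ is traceable, i.e. $G$ has a path containing all its vertices, or $G$ is isomorphic to the complete bipartite graph $K_{k,\,k+2}$. -/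

import Mathlib

namespace ZagrebTraceable

/-- `G` is `k`-connected: it has more than `k` vertices, and deleting any set of fewer than
`k` vertices leaves a connected graph. (So the complete graph on `n` vertices is
`k`-connected exactly for `k ≤ n - 1`.) -/
def IsKConnected {V : Type*} [Fintype V] (G : SimpleGraph V) (k : ℕ) : Prop :=
  k < Fintype.card V ∧
    ∀ S : Finset V, S.card < k → (G.induce {v : V | v ∉ S}).Connected

/-- The first Zagreb index of `G`: the sum of the squares of the vertex degrees. -/
def firstZagreb {V : Type*} [Fintype V] (G : SimpleGraph V) [DecidableRel G.Adj] : ℕ :=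
  ∑ v : V, G.degree v ^ 2

/-- `G` is traceable: it has a Hamiltonian path (a walk visiting every vertex exactly once). -/
def IsTraceable {V : Type*} [DecidableEq V] (G : SimpleGraph V) : Prop :=
  ∃ (u v : V) (p : G.Walk u v), p.IsHamiltonian

end ZagrebTraceable

/-!
By the Chvátal–Erdős theorem a `k`-connected graph that is not traceable has an independent set `I`
with `k + 2` vertices; put `N = n - k - 2`. The degrees on `I` lie between `δ` and `N`, so
`d ^ 2 ≤ (δ + N) * d - δ * N` there, and they add up to at most `e`. Bounding the degrees off `I` by
`Δ` and using `y - q ≤ y ^ 2 / (4 * q)` with `y = e * (δ + N)` and `q = (k + 2) * δ * N`, one sees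
that the hypothesis on `M₁` asks for the largest value `M₁` can have, so all these inequalities are
equalities. Hence `G` is bipartite with parts `I` and `Iᶜ`, and counting edges shows that either `G`
is complete bipartite or `Δ = 2`; a connected graph with `Δ ≤ 2` is traceable.
-/

namespace ZagrebTraceable

open Finset SimpleGraph

variable {V : Type*} {G : SimpleGraph V}

section LongestPath

/-- A list of vertices that traces a path of `G`, possibly empty. Paths are encoded as lists
because the proof cuts them into pieces and reassembles the pieces in another order. -/
def IsPathList (G : SimpleGraph V) (l : List V) : Prop :=
  l.IsChain G.Adj ∧ l.Nodup

/-- A path of `G` with the largest possible number of vertices. -/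
def IsLongestPathList (G : SimpleGraph V) (l : List V) : Prop :=
  IsPathList G l ∧ ∀ l', IsPathList G l' → l'.length ≤ l.length

/-- A path `m` of `G` from `x` to `y` that avoids the list `l`: a candidate for being spliced into
the path `l`. -/
structure IsDetour (G : SimpleGraph V) (l : List V) (x y : V) (m : List V) : Prop where
  isPathList : IsPathList G m
  disjoint : m.Disjoint l
  head?_eq : m.head? = some x
  getLast?_eq : m.getLast? = some y

lemma exists_isLongestPathList [Nonempty V] (G : SimpleGraph V)
    [Finite G.edgeSet] : ∃ l, IsLongestPathList G l := by
  obtain ⟨u, v, p, hp, hmax⟩ := Walk.exists_isPath_forall_isPath_length_le_length G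
  refine ⟨p.support, ⟨p.isChain_adj_support, hp.support_nodup⟩, fun l hl => ?_⟩
  rcases eq_or_ne l [] with rfl | hne
  · exact Nat.zero_le _
  · have hlen := hmax _ _ (Walk.ofSupport l hne hl.1)
      (by rw [Walk.isPath_def, Walk.support_ofSupport]; exact hl.2)
    have hsupp := (Walk.ofSupport l hne hl.1).length_support
    rw [Walk.support_ofSupport] at hsupp
    rw [hsupp, p.length_support]
    exact Nat.succ_le_succ hlen

lemma isTraceable_of_isPathList [DecidableEq V] {l : List V} (hne : l ≠ [])
    (hl : IsPathList G l) (hall : ∀ v, v ∈ l) : IsTraceable G := by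
  refine ⟨_, _, Walk.ofSupport l hne hl.1, fun v => ?_⟩
  rw [Walk.support_ofSupport]
  exact List.count_eq_one_of_mem hl.2 (hall v)

lemma IsLongestPathList.ne_nil [Nonempty V] {l : List V} (hl : IsLongestPathList G l) :
    l ≠ [] := by
  rintro rfl
  have hlen := hl.2 [Classical.arbitrary V] ⟨.singleton _, List.nodup_singleton _⟩
  simp at hlen

lemma exists_isLongestPathList_notMem [Nonempty V] [Finite G.edgeSet] [DecidableEq V]
    (hT : ¬ IsTraceable G) : ∃ l x, IsLongestPathList G l ∧ x ∉ l := by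
  obtain ⟨l, hl⟩ := exists_isLongestPathList G
  obtain ⟨x, hx⟩ : ∃ x, x ∉ l := by
    by_contra! hall
    exact hT (isTraceable_of_isPathList hl.ne_nil hl.1 hall)
  exact ⟨l, x, hl, hx⟩

lemma IsDetour.ne_nil {l m : List V} {x y : V} (hm : IsDetour G l x y m) : m ≠ [] := by
  rintro rfl
  simpa using hm.head?_eq

lemma isDetour_singleton {l : List V} {y : V} (hy : y ∉ l) : IsDetour G l y y [y] where
  isPathList := ⟨.singleton _, List.nodup_singleton _⟩
  disjoint := by simpa using hy
  head?_eq := rfl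
  getLast?_eq := rfl

lemma exists_isDetour_of_reachable {l : List V} {x y : {v | v ∉ l}}
    (h : (G.induce {v | v ∉ l}).Reachable x y) : ∃ m, IsDetour G l x y m := by
  obtain ⟨p, hp⟩ := h.exists_isPath
  refine ⟨p.support.map Subtype.val, ⟨?_, hp.support_nodup.map Subtype.val_injective⟩, ?_, ?_, ?_⟩
  · rw [List.isChain_map]
    exact p.isChain_adj_support
  · intro a ha hal
    obtain ⟨b, -, rfl⟩ := List.mem_map.1 ha
    exact b.2 hal
  · rw [List.head?_map, List.head?_eq_some_head p.support_ne_nil, p.head_support, Option.map_some]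
  · rw [List.getLast?_map, List.getLast?_eq_some_getLast p.support_ne_nil, p.getLast_support,
      Option.map_some]

lemma IsLongestPathList.not_isChain_of_perm {l m l' : List V} {x y : V}
    (hl : IsLongestPathList G l) (hm : IsDetour G l x y m) (hperm : l'.Perm (m ++ l)) :
    ¬ l'.IsChain G.Adj := by
  intro hchain
  have hnodup : l'.Nodup := by
    rw [hperm.nodup_iff, List.nodup_append']
    exact ⟨hm.isPathList.2, hl.1.2, hm.disjoint⟩
  have hlen := hl.2 l' ⟨hchain, hnodup⟩
  have hpos := List.length_pos_iff.2 hm.ne_nil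
  rw [hperm.length_eq, List.length_append] at hlen
  omega

lemma IsLongestPathList.exists_head?_not_adj_of_insert {l₁ l₂ m : List V} {x y : V}
    (hl : IsLongestPathList G (l₁ ++ l₂)) (hm : IsDetour G (l₁ ++ l₂) x y m)
    (hx : ∀ a ∈ l₁.getLast?, G.Adj a x) : ∃ b ∈ l₂.head?, ¬ G.Adj y b := by
  by_contra! hy
  refine hl.not_isChain_of_perm hm (l' := l₁ ++ (m ++ l₂)) (List.perm_append_comm_assoc _ _ _) ?_
  have hchain := List.isChain_append.1 hl.1.1
  rw [List.isChain_append, List.isChain_append, List.head?_append_of_ne_nil _ hm.ne_nil,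
    hm.head?_eq, hm.getLast?_eq]
  simpa using ⟨hchain.1, ⟨hm.isPathList.1, hchain.2.1, hy⟩, hx⟩

lemma IsLongestPathList.exists_head?_not_adj_of_insert_reverse {l₁ l₂ l₃ m : List V} {x y : V}
    (hl : IsLongestPathList G (l₁ ++ (l₂ ++ l₃))) (hm : IsDetour G (l₁ ++ (l₂ ++ l₃)) x y m)
    (hne : l₂ ≠ []) (hx : ∀ a ∈ l₁.getLast?, G.Adj a x) (hy : ∀ c ∈ l₂.getLast?, G.Adj c y) :
    ∃ b ∈ l₂.head?, ∃ d ∈ l₃.head?, ¬ G.Adj b d := by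
  by_contra! hbd
  have hperm : (l₁ ++ (m ++ (l₂.reverse ++ l₃))).Perm (m ++ (l₁ ++ (l₂ ++ l₃))) :=
    (List.perm_append_comm_assoc _ _ _).trans
      ((((List.reverse_perm l₂).append_right l₃).append_left l₁).append_left m)
  refine hl.not_isChain_of_perm hm hperm ?_
  obtain ⟨hchain₁, hchain₂₃, -⟩ := List.isChain_append.1 hl.1.1
  obtain ⟨hchain₂, hchain₃, -⟩ := List.isChain_append.1 hchain₂₃
  have hchain₂' : l₂.reverse.IsChain G.Adj :=
    List.isChain_reverse.2 (hchain₂.imp fun _ _ h => h.symm)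
  rw [List.isChain_append, List.isChain_append, List.isChain_append,
    List.head?_append_of_ne_nil _ hm.ne_nil,
    List.head?_append_of_ne_nil _ (List.reverse_ne_nil_iff.2 hne), List.head?_reverse,
    List.getLast?_reverse, hm.head?_eq, hm.getLast?_eq]
  simpa using
    ⟨hchain₁, ⟨hm.isPathList.1, ⟨hchain₂', hchain₃, hbd⟩, fun c hc => (hy c hc).symm⟩, hx⟩

lemma IsLongestPathList.left_ne_nil_of_adj {l₁ l₂ : List V} {a y : V}
    (hl : IsLongestPathList G (l₁ ++ a :: l₂)) (hy : y ∉ l₁ ++ a :: l₂) (hay : G.Adj a y) :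
    l₁ ≠ [] := by
  rintro rfl
  obtain ⟨b, hb, hyb⟩ := hl.exists_head?_not_adj_of_insert (isDetour_singleton hy) (by simp)
  obtain rfl : a = b := by simpa using hb
  exact hyb hay.symm

lemma IsLongestPathList.right_ne_nil_of_adj {l₁ l₂ : List V} {a y : V}
    (hl : IsLongestPathList G (l₁ ++ a :: l₂)) (hy : y ∉ l₁ ++ a :: l₂) (hay : G.Adj a y) :
    l₂ ≠ [] := by
  rintro rfl
  obtain ⟨b, hb, -⟩ := IsLongestPathList.exists_head?_not_adj_of_insert (l₁ := l₁ ++ [a]) (l₂ := [])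
    (by simpa using hl) (isDetour_singleton (by simpa using hy)) (by simpa using hay)
  simp at hb

lemma exists_three_le_degree_of_not_isTraceable [Fintype V] [DecidableEq V] [DecidableRel G.Adj]
    (hG : G.Connected) (hT : ¬ IsTraceable G) : ∃ v, 3 ≤ G.degree v := by
  have := hG.nonempty
  obtain ⟨l, x, hl, hx⟩ := exists_isLongestPathList_notMem hT
  obtain ⟨w, hw⟩ := List.exists_mem_of_ne_nil l hl.ne_nil
  obtain ⟨p⟩ := hG.preconnected x w
  obtain ⟨⟨⟨y, a⟩, hya⟩, -, hy : y ∉ l, ha⟩ := p.exists_boundary_dart {v | v ∉ l} hx (by simpa)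
  obtain ⟨l₁, l₂, rfl⟩ := List.append_of_mem (not_not.1 ha)
  obtain ⟨l₁, b, rfl⟩ := (List.eq_nil_or_concat l₁).resolve_left (hl.left_ne_nil_of_adj hy hya.symm)
  obtain ⟨c, l₂, rfl⟩ := List.exists_cons_of_ne_nil (hl.right_ne_nil_of_adj hy hya.symm)
  obtain ⟨hchain, hnodup⟩ := hl.1
  have hba : G.Adj b a := (List.isChain_append.1 hchain).2.2 b (by simp) a (by simp)
  have hac : G.Adj a c := (List.isChain_append.1 hchain).2.1.rel
  have hbc : b ≠ c := by
    rintro rfl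
    simp [List.nodup_append] at hnodup
  have hyb : y ≠ b := by
    rintro rfl
    simp at hy
  have hyc : y ≠ c := by
    rintro rfl
    simp at hy
  have hsub : {y, b, c} ⊆ G.neighborFinset a := by
    simp [Finset.insert_subset_iff, hya.symm, hba.symm, hac]
  exact ⟨a, by simpa [card_eq_three.2 ⟨y, b, c, hyb, hyc, hbc, rfl⟩] using card_le_card hsub⟩

end LongestPath

section SuccessorPositions

/-- The set `H` lies in one component of `G` minus the list `l`. -/
def IsDetourConnected (G : SimpleGraph V) (l : List V) (H : Set V) : Prop :=
  ∀ y ∈ H, ∀ z ∈ H, ∃ m, IsDetour G l y z m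

open Classical in
/-- The positions on the path `l` whose predecessor, if there is one, has a neighbour in `H`.
Position `0` counts as soon as `H` is nonempty, so the first vertex needs no separate treatment. -/
noncomputable def successorPositions (G : SimpleGraph V) (l : List V) (H : Set V) :
    Finset (Fin l.length) :=
  {i | ∃ y ∈ H, ∀ a ∈ (l.take i).getLast?, G.Adj a y}

variable {l : List V} {H : Set V}

lemma mem_successorPositions {i : Fin l.length} :
    i ∈ successorPositions G l H ↔ ∃ y ∈ H, ∀ a ∈ (l.take i).getLast?, G.Adj a y := by
  simp [successorPositions]

lemma IsLongestPathList.not_adj_getElem (hl : IsLongestPathList G l)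
    (hH : IsDetourConnected G l H) {i : Fin l.length} (hi : i ∈ successorPositions G l H) {z : V}
    (hz : z ∈ H) : ¬ G.Adj z l[i] := by
  obtain ⟨y, hy, hya⟩ := mem_successorPositions.1 hi
  obtain ⟨m, hm⟩ := hH y hy z hz
  rw [← l.take_append_drop i] at hl hm
  obtain ⟨b, hb, hzb⟩ := hl.exists_head?_not_adj_of_insert hm hya
  obtain rfl : l[i] = b := by simpa [List.head?_drop] using hb
  exact hzb

lemma IsLongestPathList.not_adj_getElem_getElem (hl : IsLongestPathList G l)
    (hH : IsDetourConnected G l H) {i j : Fin l.length} (hi : i ∈ successorPositions G l H)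
    (hj : j ∈ successorPositions G l H) (hij : i < j) : ¬ G.Adj l[i] l[j] := by
  obtain ⟨y, hy, hya⟩ := mem_successorPositions.1 hi
  obtain ⟨z, hz, hzc⟩ := mem_successorPositions.1 hj
  obtain ⟨m, hm⟩ := hH y hy z hz
  have hlt : (i : ℕ) < j := hij
  have hsplit : l = l.take i ++ ((l.drop i).take (j - i) ++ l.drop j) := by
    have hdrop : l.drop j = (l.drop i).drop (j - i) := by
      rw [List.drop_drop, Nat.add_sub_cancel' hlt.le]
    rw [hdrop, List.take_append_drop, List.take_append_drop]
  have hne : (l.drop i).take (j - i) ≠ [] := by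
    rw [← List.length_pos_iff, List.length_take, List.length_drop]
    omega
  have hlast : ((l.drop i).take (j - i)).getLast? = (l.take j).getLast? := by
    have htake : l.take j = l.take i ++ (l.drop i).take (j - i) := by
      rw [← List.take_add, Nat.add_sub_cancel' hlt.le]
    rw [htake, List.getLast?_append_of_ne_nil _ hne]
  rw [hsplit] at hl hm
  obtain ⟨b, hb, d, hd, hbd⟩ :=
    hl.exists_head?_not_adj_of_insert_reverse hm hne hya (by rwa [hlast])
  obtain rfl : l[i] = b := by
    simpa [List.head?_take, List.head?_drop, (Nat.sub_pos_of_lt hlt).ne'] using hb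
  obtain rfl : l[j] = d := by simpa [List.head?_drop] using hd
  exact hbd

lemma IsLongestPathList.card_add_one_le_card_successorPositions {S : Finset V}
    (hl : IsLongestPathList G l) (hHl : ∀ y ∈ H, y ∉ l) (hH : H.Nonempty)
    (hS : ∀ a ∈ S, a ∈ l ∧ ∃ y ∈ H, G.Adj a y) : #S + 1 ≤ #(successorPositions G l H) := by
  classical
  have := hH.to_subtype.map Subtype.val
  rw [← card_insertNone]
  -- A position is sent to the vertex preceding it, position `0` to `none`.
  refine card_le_card_of_surjOn (fun i : Fin l.length => (l.take i).getLast?) fun o ho => ?_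
  rcases o with _ | a
  · obtain ⟨y, hy⟩ := hH
    exact ⟨⟨0, List.length_pos_iff.2 hl.ne_nil⟩, mem_successorPositions.2 ⟨y, hy, by simp⟩, by simp⟩
  · obtain ⟨hal, y, hy, hay⟩ := hS a (by simpa using ho)
    obtain ⟨l₁, l₂, rfl⟩ := List.append_of_mem hal
    have hpos := List.length_pos_iff.2 (hl.right_ne_nil_of_adj (hHl y hy) hay)
    have hlast : ((l₁ ++ a :: l₂).take (l₁.length + 1)).getLast? = some a := by
      simp [List.take_append]
    refine ⟨⟨l₁.length + 1, by simpa using hpos⟩, mem_successorPositions.2 ⟨y, hy, ?_⟩, hlast⟩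
    simpa [hlast] using hay

lemma IsLongestPathList.card_successorPositions_add_one_le_indepNum [Finite V]
    (hl : IsLongestPathList G l) (hH : IsDetourConnected G l H) {x : V} (hx : x ∈ H)
    (hxl : x ∉ l) : #(successorPositions G l H) + 1 ≤ G.indepNum := by
  classical
  set B := (successorPositions G l H).map ⟨l.get, List.nodup_iff_injective_get.1 hl.1.2⟩ with hB
  have hxB : x ∉ B := by
    simp only [hB, Finset.mem_map, not_exists, not_and]
    rintro i - rfl
    exact hxl (l.get_mem i)
  have hind : G.IsIndepSet (insert x B : Finset V) := by
    have hsymm : Std.Symm fun v w => ¬ G.Adj v w := ⟨fun _ _ hvw hwv => hvw hwv.symm⟩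
    rw [coe_insert, IsIndepSet, Set.pairwise_insert_of_symm]
    constructor
    · simp only [hB, coe_map, Function.Embedding.coeFn_mk]
      rintro _ ⟨i, hi, rfl⟩ _ ⟨j, hj, rfl⟩ hij
      rcases lt_trichotomy i j with h | rfl | h
      · exact hl.not_adj_getElem_getElem hH hi hj h
      · exact absurd rfl hij
      · exact fun hadj => hl.not_adj_getElem_getElem hH hj hi h hadj.symm
    · simp only [hB, coe_map, Function.Embedding.coeFn_mk]
      rintro _ ⟨i, hi, rfl⟩ -
      exact hl.not_adj_getElem hH hi hx
  rw [← card_map ⟨l.get, List.nodup_iff_injective_get.1 hl.1.2⟩, ← card_insert_of_notMem hxB]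
  exact hind.card_le_indepNum

end SuccessorPositions

section Connectivity

variable {k : ℕ}

lemma IsKConnected.le_card_of_boundary_subset [Fintype V] (hG : IsKConnected G k) {H : Set V}
    {S : Finset V} {x w : V} (hx : x ∈ H) (hxS : x ∉ S) (hw : w ∉ H) (hwS : w ∉ S)
    (hH : ∀ y ∈ H, ∀ z ∉ H, G.Adj y z → z ∈ S) : k ≤ #S := by
  by_contra! hlt
  obtain ⟨p⟩ := (hG.2 S hlt).preconnected ⟨x, hxS⟩ ⟨w, hwS⟩
  obtain ⟨d, -, hfst, hsnd⟩ := p.exists_boundary_dart (Subtype.val ⁻¹' H) hx hw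
  exact d.snd.2 (hH _ hfst _ hsnd d.adj)

lemma IsKConnected.connected [Fintype V] (hG : IsKConnected G k) (hk : 1 ≤ k) : G.Connected := by
  have hconn := hG.2 ∅ hk
  rw [show {v : V | v ∉ (∅ : Finset V)} = Set.univ by simp] at hconn
  exact G.induceUnivIso.connected_iff.1 hconn

lemma IsKConnected.le_degree [Fintype V] [DecidableRel G.Adj] (hG : IsKConnected G k) (v : V) :
    k ≤ G.degree v := by
  classical
  by_contra! hlt
  have hcard : #(insert v (G.neighborFinset v)) < #(univ : Finset V) := by
    have hinsert := card_insert_le v (G.neighborFinset v)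
    have hV := hG.1
    rw [card_neighborFinset_eq_degree] at hinsert
    rw [card_univ]
    omega
  obtain ⟨w, -, hw⟩ := exists_mem_notMem_of_card_lt_card hcard
  rw [Finset.mem_insert, not_or] at hw
  have hle := hG.le_card_of_boundary_subset (H := {v}) (S := G.neighborFinset v) rfl (by simp) hw.1
    hw.2 (by simp +contextual)
  rw [card_neighborFinset_eq_degree] at hle
  omega

/-- The component of `G` minus the vertices of the list `l` that contains `x`; it is empty when `x`
lies on `l`. -/
def offListComponent (G : SimpleGraph V) (l : List V) (x : V) : Set V :=
  {y | ∃ (hx : x ∉ l) (hy : y ∉ l), (G.induce {v | v ∉ l}).Reachable ⟨x, hx⟩ ⟨y, hy⟩}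

lemma isDetourConnected_offListComponent (G : SimpleGraph V) (l : List V) (x : V) :
    IsDetourConnected G l (offListComponent G l x) := by
  rintro y ⟨_, hy, hxy⟩ z ⟨_, hz, hxz⟩
  exact exists_isDetour_of_reachable (hxy.symm.trans hxz)

lemma mem_offListComponent_of_adj {l : List V} {x y z : V} (hy : y ∈ offListComponent G l x)
    (hyz : G.Adj y z) (hz : z ∉ l) : z ∈ offListComponent G l x := by
  obtain ⟨hx, hy, hxy⟩ := hy
  exact ⟨hx, hz, hxy.trans (Adj.reachable (by simpa using hyz))⟩

/-- The Chvátal–Erdős theorem for Hamiltonian paths. A component off a longest path has at least `k`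
neighbours on the path; their successors, the first vertex of the path and a vertex of the component
form an independent set. -/
theorem IsKConnected.isTraceable_of_indepNum_le [Fintype V] [DecidableEq V] (hG : IsKConnected G k)
    (hα : G.indepNum ≤ k + 1) : IsTraceable G := by
  classical
  by_contra hT
  have : Nonempty V := Fintype.card_pos_iff.1 (Nat.zero_lt_of_lt hG.1)
  obtain ⟨l, x, hl, hx⟩ := exists_isLongestPathList_notMem hT
  set H := offListComponent G l x
  have hxH : x ∈ H := ⟨hx, hx, .rfl⟩
  have hHl : ∀ y ∈ H, y ∉ l := fun y ⟨_, hy, _⟩ => hy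
  set S : Finset V := {a | a ∈ l ∧ ∃ y ∈ H, G.Adj a y} with hS
  obtain ⟨w, l', hl'⟩ := List.exists_cons_of_ne_nil hl.ne_nil
  have hwl : w ∈ l := by simp [hl']
  have hwS : w ∉ S := by
    simp only [hS, mem_filter_univ, not_and, not_exists]
    intro _ y hy hwy
    exact IsLongestPathList.left_ne_nil_of_adj (l₁ := []) (hl' ▸ hl) (hl' ▸ hHl y hy) hwy rfl
  have hkS : k ≤ #S := by
    refine hG.le_card_of_boundary_subset hxH (by simp [hS, hx]) (fun hw => hHl w hw hwl) hwS ?_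
    intro y hy z hz hyz
    have hzl : z ∈ l := by_contra fun hzl => hz (mem_offListComponent_of_adj hy hyz hzl)
    exact mem_filter_univ _ |>.2 ⟨hzl, y, hy, hyz.symm⟩
  have hSB : #S + 1 ≤ #(successorPositions G l H) :=
    hl.card_add_one_le_card_successorPositions hHl ⟨x, hxH⟩ fun a ha =>
      (mem_filter_univ a).1 ha
  have hBα : #(successorPositions G l H) + 1 ≤ G.indepNum :=
    hl.card_successorPositions_add_one_le_indepNum (isDetourConnected_offListComponent G l x) hxH
      hx
  omega

lemma IsKConnected.exists_isIndepSet_card_eq [Fintype V] [DecidableEq V] (hG : IsKConnected G k)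
    (hT : ¬ IsTraceable G) : ∃ I : Finset V, G.IsIndepSet I ∧ #I = k + 2 := by
  have hlt : k + 2 ≤ G.indepNum := not_le.1 fun hα => hT (hG.isTraceable_of_indepNum_le hα)
  obtain ⟨s, hs⟩ := G.exists_isNIndepSet_indepNum
  obtain ⟨I, hIs, hI⟩ := exists_subset_card_eq (hlt.trans_eq hs.card_eq.symm)
  exact ⟨I, hs.isIndepSet.mono (coe_subset.2 hIs), hI⟩

end Connectivity

section Bipartite

variable [Fintype V]

lemma nonempty_iso_completeBipartiteGraph {α β : Type*} [Fintype α] [Fintype β] {I J : Finset V}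
    (hIJ : IsCompl I J) (hbip : G.IsBipartiteWith I J) (hcomp : G.IsCompleteBetween I J)
    (hα : #I = Fintype.card α) (hβ : #J = Fintype.card β) :
    Nonempty (G ≃g completeBipartiteGraph α β) := by
  classical
  obtain rfl := hIJ.compl_eq
  let eα : α ≃ I := Fintype.equivOfCardEq (by simpa using hα.symm)
  let eβ : β ≃ {v // v ∉ I} := Fintype.equivOfCardEq (by simpa [card_compl] using hβ.symm)
  let e : α ⊕ β ≃ V := (Equiv.sumCongr eα eβ).trans (Equiv.sumCompl (· ∈ I))
  have hinl : ∀ x, e (.inl x) ∈ (I : Set V) := fun x => (eα x).2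
  have hinr : ∀ y, e (.inr y) ∈ (↑Iᶜ : Set V) := fun y => by
    rw [Finset.mem_coe, mem_compl]
    exact (eβ y).2
  have hdisj := Set.disjoint_left.1 hbip.disjoint
  refine ⟨Iso.symm ⟨e, ?_⟩⟩
  rintro (x | x) (y | y)
  · simpa using fun hadj => hdisj (hinl y) (hbip.mem_of_mem_adj (hinl x) hadj)
  · simpa using hcomp (hinl x) (hinr y)
  · simpa using (hcomp (hinl y) (hinr x)).symm
  · simpa using fun hadj => hdisj (hbip.mem_of_mem_adj' (hinr y) hadj) (hinr x)

variable [DecidableEq V] {I : Finset V}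

lemma isKConnected_of_isCompleteBetween_compl {m : ℕ} (hm : 1 ≤ m)
    (hcomp : G.IsCompleteBetween I ↑Iᶜ) (hI : m ≤ #I) (hJ : m ≤ #Iᶜ) : IsKConnected G m := by
  have hcard := card_add_card_compl I
  refine ⟨by omega, fun S hS => ?_⟩
  obtain ⟨i, hi, hiS⟩ := exists_mem_notMem_of_card_lt_card (hS.trans_le hI)
  obtain ⟨j, hj, hjS⟩ := exists_mem_notMem_of_card_lt_card (hS.trans_le hJ)
  have hij : (G.induce {v | v ∉ S}).Adj ⟨i, hiS⟩ ⟨j, hjS⟩ := hcomp hi hj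
  have hreach : ∀ w, (G.induce {v | v ∉ S}).Reachable w ⟨j, hjS⟩ := by
    rintro ⟨w, hwS⟩
    by_cases hw : w ∈ I
    · have hwj : (G.induce {v | v ∉ S}).Adj ⟨w, hwS⟩ ⟨j, hjS⟩ := hcomp hw hj
      exact hwj.reachable
    · have hiw : (G.induce {v | v ∉ S}).Adj ⟨i, hiS⟩ ⟨w, hwS⟩ := hcomp hi (by simpa using hw)
      exact hiw.symm.reachable.trans hij.reachable
  have : Nonempty {v | v ∉ S} := ⟨⟨i, hiS⟩⟩
  exact ⟨fun a b => (hreach a).trans (hreach b).symm⟩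

lemma indepNum_le_of_isCompleteBetween_compl {m : ℕ} (hcomp : G.IsCompleteBetween I ↑Iᶜ)
    (hI : #I ≤ m) (hJ : #Iᶜ ≤ m) : G.indepNum ≤ m := by
  obtain ⟨s, hs⟩ := G.exists_isNIndepSet_indepNum
  rw [← hs.card_eq]
  by_contra! hlt
  obtain ⟨v, hv, hvI⟩ := exists_mem_notMem_of_card_lt_card (hI.trans_lt hlt)
  obtain ⟨u, hu, huI⟩ := exists_mem_notMem_of_card_lt_card (hJ.trans_lt hlt)
  have huv := hcomp (by simpa using huI) (by simpa using hvI)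
  exact hs.isIndepSet hu hv huv.ne huv

lemma isTraceable_of_isCompleteBetween_compl (hcomp : G.IsCompleteBetween I ↑Iᶜ)
    (hlt : #Iᶜ ≤ #I) (hle : #I ≤ #Iᶜ + 1) (hJ : Iᶜ.Nonempty) : IsTraceable G :=
  (isKConnected_of_isCompleteBetween_compl hJ.card_pos hcomp hlt le_rfl).isTraceable_of_indepNum_le
    (indepNum_le_of_isCompleteBetween_compl hcomp hle (Nat.le_succ _))

end Bipartite

section SumsOfSquares

variable {ι : Type*} {s : Finset ι} {f : ι → ℝ} {m M : ℝ}

lemma sq_le_of_mem_Icc {x : ℝ} (hx : x ∈ Set.Icc m M) : x ^ 2 ≤ (m + M) * x - m * M := by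
  linarith [mul_nonneg (sub_nonneg.2 hx.1) (sub_nonneg.2 hx.2)]

lemma sq_eq_add_mul_sub_mul_iff {x : ℝ} : x ^ 2 = (m + M) * x - m * M ↔ x = m ∨ x = M := by
  rw [← sub_eq_zero (a := x) (b := m), ← sub_eq_zero (a := x) (b := M), ← mul_eq_zero]
  constructor <;> intro h <;> linarith

lemma sum_add_mul_sub_mul :
    ∑ i ∈ s, ((m + M) * f i - m * M) = (m + M) * ∑ i ∈ s, f i - #s * (m * M) := by
  rw [sum_sub_distrib, ← mul_sum, sum_const, nsmul_eq_mul]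

lemma sum_sq_le_of_mem_Icc (hf : ∀ i ∈ s, f i ∈ Set.Icc m M) :
    ∑ i ∈ s, f i ^ 2 ≤ (m + M) * ∑ i ∈ s, f i - #s * (m * M) := by
  rw [← sum_add_mul_sub_mul]
  exact sum_le_sum fun i hi => sq_le_of_mem_Icc (hf i hi)

lemma sum_sq_eq_iff_of_mem_Icc (hf : ∀ i ∈ s, f i ∈ Set.Icc m M) :
    ∑ i ∈ s, f i ^ 2 = (m + M) * ∑ i ∈ s, f i - #s * (m * M) ↔ ∀ i ∈ s, f i = m ∨ f i = M := by
  rw [← sum_add_mul_sub_mul, sum_eq_sum_iff_of_le fun i hi => sq_le_of_mem_Icc (hf i hi)]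
  exact forall₂_congr fun _ _ => sq_eq_add_mul_sub_mul_iff

lemma sub_le_sq_div_four_mul {q : ℝ} (hq : 0 < q) (y : ℝ) : y - q ≤ y ^ 2 / (4 * q) := by
  rw [le_div_iff₀ (by positivity)]
  linarith [sq_nonneg (y - 2 * q)]

lemma sub_eq_sq_div_four_mul_iff {q : ℝ} (hq : 0 < q) {y : ℝ} :
    y - q = y ^ 2 / (4 * q) ↔ y = 2 * q := by
  rw [eq_div_iff (by positivity), ← sub_eq_zero (a := y) (b := 2 * q), ← sq_eq_zero_iff]
  constructor <;> intro h <;> linarith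

end SumsOfSquares

section Zagreb

variable [Fintype V] [DecidableRel G.Adj]

lemma sum_sq_degree_le (s : Finset V) :
    ∑ v ∈ s, G.degree v ^ 2 ≤ #s * G.maxDegree ^ 2 :=
  sum_le_card_nsmul _ _ _ fun v _ => Nat.pow_le_pow_left (G.degree_le_maxDegree v) 2

lemma sum_sq_degree_eq_iff (s : Finset V) :
    ∑ v ∈ s, G.degree v ^ 2 = #s * G.maxDegree ^ 2 ↔ ∀ v ∈ s, G.degree v = G.maxDegree := by
  rw [← smul_eq_mul, ← sum_const,
    sum_eq_sum_iff_of_le fun v _ => Nat.pow_le_pow_left (G.degree_le_maxDegree v) 2]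
  exact forall₂_congr fun _ _ => Nat.pow_left_inj two_ne_zero

variable {I : Finset V}

lemma card_biUnion_incidenceFinset [DecidableEq V] (hI : G.IsIndepSet I) :
    #(I.biUnion fun u => G.incidenceFinset u) = ∑ u ∈ I, G.degree u := by
  rw [card_biUnion]
  · simp_rw [card_incidenceFinset_eq_degree]
  · intro u hu v hv huv
    rw [Function.onFun, ← disjoint_coe, coe_incidenceFinset, coe_incidenceFinset,
      Set.disjoint_iff_inter_eq_empty]
    exact G.incidenceSet_inter_incidenceSet_of_not_adj (hI hu hv huv) huv

lemma sum_degree_le_card_edgeFinset (hI : G.IsIndepSet I) :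
    ∑ u ∈ I, G.degree u ≤ #G.edgeFinset := by
  classical
  rw [← card_biUnion_incidenceFinset hI]
  exact card_le_card (biUnion_subset.2 fun u _ => G.incidenceFinset_subset u)

variable [DecidableEq V]

lemma neighborFinset_subset_compl_of_isIndepSet (hI : G.IsIndepSet I) {u : V} (hu : u ∈ I) :
    G.neighborFinset u ⊆ Iᶜ := fun v hv => mem_compl.2 fun hvI =>
  hI hu hvI (G.ne_of_adj ((G.mem_neighborFinset u v).1 hv)) ((G.mem_neighborFinset u v).1 hv)

lemma degree_le_card_compl (hI : G.IsIndepSet I) {u : V} (hu : u ∈ I) : G.degree u ≤ #Iᶜ := by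
  rw [← card_neighborFinset_eq_degree]
  exact card_le_card (neighborFinset_subset_compl_of_isIndepSet hI hu)

lemma minDegree_le_card_compl (hI : G.IsIndepSet I) (hne : I.Nonempty) : G.minDegree ≤ #Iᶜ := by
  obtain ⟨u, hu⟩ := hne
  exact (G.minDegree_le_degree u).trans (degree_le_card_compl hI hu)

lemma isCompleteBetween_compl_of_degree_eq_card_compl (hI : G.IsIndepSet I)
    (hdeg : ∀ u ∈ I, G.degree u = #Iᶜ) : G.IsCompleteBetween I ↑Iᶜ := by
  intro u hu v hv
  have hsub := neighborFinset_subset_compl_of_isIndepSet hI hu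
  have heq := eq_of_subset_of_card_le hsub (by rw [card_neighborFinset_eq_degree, hdeg u hu])
  rwa [← mem_neighborFinset, heq]

lemma isBipartiteWith_compl_of_sum_degree_eq (hI : G.IsIndepSet I)
    (hsum : ∑ u ∈ I, G.degree u = #G.edgeFinset) : G.IsBipartiteWith I ↑Iᶜ where
  disjoint := by simpa using disjoint_compl_right
  mem_of_adj v w hvw := by
    have hcover : (I.biUnion fun u => G.incidenceFinset u) = G.edgeFinset :=
      eq_of_subset_of_card_le (biUnion_subset.2 fun u _ => G.incidenceFinset_subset u)
        (by rw [card_biUnion_incidenceFinset hI, hsum])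
    have hmem : s(v, w) ∈ I.biUnion fun u => G.incidenceFinset u := by
      rwa [hcover, mem_edgeFinset, mem_edgeSet]
    have hor : v ∈ I ∨ w ∈ I := by
      obtain ⟨u, hu, huvw⟩ := Finset.mem_biUnion.1 hmem
      rw [mem_incidenceFinset, mk'_mem_incidenceSet_iff] at huvw
      rcases huvw.2 with rfl | rfl
      exacts [.inl hu, .inr hu]
    have hnot : ¬ (v ∈ I ∧ w ∈ I) := fun ⟨hv, hw⟩ => hI hv hw hvw.ne hvw
    simp only [coe_compl, Set.mem_compl_iff, Finset.mem_coe]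
    tauto

/-- The structure forced on `G` when the upper bound for the first Zagreb index coming from the
independent set `I` is attained. -/
structure IsExtremal (G : SimpleGraph V) [DecidableRel G.Adj] (I : Finset V) : Prop where
  isBipartiteWith : G.IsBipartiteWith I ↑Iᶜ
  degree_eq_or_eq : ∀ u ∈ I, G.degree u = G.minDegree ∨ G.degree u = #Iᶜ
  degree_eq_maxDegree : ∀ v ∈ Iᶜ, G.degree v = G.maxDegree
  card_edgeFinset_mul : #G.edgeFinset * (G.minDegree + #Iᶜ) = 2 * (#I * G.minDegree * #Iᶜ)

lemma isExtremal_of_le_firstZagreb (hI : G.IsIndepSet I) (hne : I.Nonempty)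
    (hδ : 0 < G.minDegree)
    (hM : #Iᶜ * (G.maxDegree : ℝ) ^ 2 + (#G.edgeFinset * (G.minDegree + #Iᶜ : ℝ)) ^ 2 /
      (4 * (#I * G.minDegree * #Iᶜ)) ≤ firstZagreb G) : IsExtremal G I := by
  have hc : 0 < #I := hne.card_pos
  have hN : 0 < #Iᶜ := hδ.trans_le (minDegree_le_card_compl hI hne)
  have hq : (0 : ℝ) < #I * G.minDegree * #Iᶜ := by positivity
  have hIcc : ∀ v ∈ I, (G.degree v : ℝ) ∈ Set.Icc (G.minDegree : ℝ) #Iᶜ := fun v hv =>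
    ⟨mod_cast G.minDegree_le_degree v, mod_cast degree_le_card_compl hI hv⟩
  have hsplit : (firstZagreb G : ℝ) =
      ∑ v ∈ I, (G.degree v : ℝ) ^ 2 + ∑ v ∈ Iᶜ, (G.degree v : ℝ) ^ 2 := by
    rw [sum_add_sum_compl, firstZagreb]
    push_cast
    rfl
  have hinside := sum_sq_le_of_mem_Icc hIcc
  have hedges : (G.minDegree + #Iᶜ : ℝ) * ∑ v ∈ I, (G.degree v : ℝ) ≤
      (G.minDegree + #Iᶜ) * #G.edgeFinset := by
    gcongr
    exact_mod_cast sum_degree_le_card_edgeFinset hI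
  have hamgm := sub_le_sq_div_four_mul hq (#G.edgeFinset * (G.minDegree + #Iᶜ : ℝ))
  have houtside : ∑ v ∈ Iᶜ, (G.degree v : ℝ) ^ 2 ≤ #Iᶜ * (G.maxDegree : ℝ) ^ 2 :=
    mod_cast sum_sq_degree_le Iᶜ
  constructor
  · have hsum := mul_left_cancel₀ (by positivity) (hedges.antisymm (by linarith))
    exact isBipartiteWith_compl_of_sum_degree_eq hI (mod_cast hsum)
  · have hdeg := (sum_sq_eq_iff_of_mem_Icc hIcc).1 (hinside.antisymm (by linarith))
    exact mod_cast hdeg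
  · exact (sum_sq_degree_eq_iff Iᶜ).1 (mod_cast houtside.antisymm (by linarith))
  · exact_mod_cast (sub_eq_sq_div_four_mul_iff hq).1 (hamgm.antisymm (by linarith))

lemma IsExtremal.card_edgeFinset_eq (h : IsExtremal G I) :
    #G.edgeFinset = #Iᶜ * G.maxDegree := by
  rw [← isBipartiteWith_sum_degrees_eq_card_edges' h.isBipartiteWith,
    sum_congr rfl h.degree_eq_maxDegree, sum_const, smul_eq_mul]

lemma IsExtremal.isIndepSet (h : IsExtremal G I) : G.IsIndepSet I := fun _ hu _ hv _ huv =>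
  Set.disjoint_left.1 h.isBipartiteWith.disjoint hv (h.isBipartiteWith.mem_of_mem_adj hu huv)

lemma IsExtremal.maxDegree_mul (h : IsExtremal G I) (hne : Iᶜ.Nonempty) :
    G.maxDegree * (G.minDegree + #Iᶜ) = 2 * (#I * G.minDegree) := by
  refine Nat.eq_of_mul_eq_mul_left hne.card_pos ?_
  rw [← mul_assoc, ← h.card_edgeFinset_eq, h.card_edgeFinset_mul]
  ring

lemma IsExtremal.maxDegree_le_card (h : IsExtremal G I) (hne : Iᶜ.Nonempty) :
    G.maxDegree ≤ #I := by
  obtain ⟨v, hv⟩ := hne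
  rw [← h.degree_eq_maxDegree v hv]
  exact isBipartiteWith_degree_le' h.isBipartiteWith hv

lemma IsExtremal.minDegree_eq_or_card_compl_le_maxDegree (h : IsExtremal G I)
    (hδ : 0 < G.minDegree) (hne : I.Nonempty) : G.minDegree = #Iᶜ ∨ #Iᶜ ≤ G.maxDegree := by
  by_cases hdeg : ∃ u ∈ I, G.degree u = #Iᶜ
  · obtain ⟨u, -, hu⟩ := hdeg
    exact .inr (hu ▸ G.degree_le_maxDegree u)
  · push Not at hdeg
    have hmin : ∀ u ∈ I, G.degree u = G.minDegree := fun u hu =>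
      (h.degree_eq_or_eq u hu).resolve_right (hdeg u hu)
    have hedges : #G.edgeFinset = #I * G.minDegree := by
      rw [← isBipartiteWith_sum_degrees_eq_card_edges h.isBipartiteWith, sum_congr rfl hmin,
        sum_const, smul_eq_mul]
    have hmul : #I * G.minDegree * (G.minDegree + #Iᶜ) = #I * G.minDegree * (2 * #Iᶜ) := by
      rw [← hedges, h.card_edgeFinset_mul, hedges]
      ring
    have hadd := Nat.eq_of_mul_eq_mul_left (Nat.mul_pos hne.card_pos hδ) hmul
    left
    omega

lemma eq_two_of_mul_add_eq {k δ N Δ : ℕ} (hkδ : k ≤ δ) (hδN : δ < N) (hNΔ : N ≤ Δ)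
    (hΔ : Δ ≤ k + 2) (hmul : Δ * (δ + N) = 2 * ((k + 2) * δ)) : Δ = 2 := by
  obtain rfl | hlt := hΔ.eq_or_lt
  · have hadd : δ + N = 2 * δ := Nat.eq_of_mul_eq_mul_left (by omega) (hmul.trans (by ring))
    omega
  · obtain rfl : N = k + 1 := by omega
    obtain rfl : Δ = k + 1 := by omega
    obtain rfl : δ = k := by omega
    nlinarith

lemma IsExtremal.minDegree_eq_card_compl_or_maxDegree_eq_two {k : ℕ} (h : IsExtremal G I)
    (hk : 1 ≤ k) (hI : #I = k + 2) (hδ : k ≤ G.minDegree) :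
    G.minDegree = #Iᶜ ∨ G.maxDegree = 2 := by
  have hne : I.Nonempty := card_pos.1 (by omega)
  have hδN := minDegree_le_card_compl h.isIndepSet hne
  have hcompl : Iᶜ.Nonempty := card_pos.1 (by omega)
  refine or_iff_not_imp_left.2 fun hlt => ?_
  have hNΔ := (h.minDegree_eq_or_card_compl_le_maxDegree (by omega) hne).resolve_left hlt
  exact eq_two_of_mul_add_eq hδ (lt_of_le_of_ne hδN hlt) hNΔ (hI ▸ h.maxDegree_le_card hcompl)
    (hI ▸ h.maxDegree_mul hcompl)

lemma IsExtremal.isTraceable_or_nonempty_iso {k : ℕ} (h : IsExtremal G I)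
    (hI : #I = k + 2) (hδ : k ≤ G.minDegree) (hN : G.minDegree = #Iᶜ) (hne : Iᶜ.Nonempty) :
    IsTraceable G ∨ Nonempty (G ≃g completeBipartiteGraph (Fin k) (Fin (k + 2))) := by
  have hcomp : G.IsCompleteBetween I ↑Iᶜ :=
    isCompleteBetween_compl_of_degree_eq_card_compl h.isIndepSet fun u hu =>
      (h.degree_eq_or_eq u hu).elim (·.trans hN) id
  have hle : #Iᶜ ≤ #I :=
    hN ▸ G.minDegree_le_maxDegree.trans (h.maxDegree_le_card hne)
  rcases (hδ.trans_eq hN).eq_or_lt with hk | hk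
  · exact .inr (nonempty_iso_completeBipartiteGraph isCompl_compl.symm h.isBipartiteWith.symm
      hcomp.symm (by simpa using hk.symm) (by simpa using hI))
  · exact .inl (isTraceable_of_isCompleteBetween_compl hcomp hle (by omega) hne)

end Zagreb

end ZagrebTraceable

theorem theorem2_general {V : Type*} [Fintype V] [DecidableEq V] (G : SimpleGraph V)
    [DecidableRel G.Adj] (k : ℕ) (hk : 1 ≤ k) (hG : ZagrebTraceable.IsKConnected G k)
    (hM : (ZagrebTraceable.firstZagreb G : ℝ) ≥
      ((Fintype.card V : ℝ) - k - 2) * (G.maxDegree : ℝ) ^ 2 +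
        ((G.edgeFinset.card : ℝ) * ((G.minDegree : ℝ) + (Fintype.card V : ℝ) - k - 2)) ^ 2 /
          (4 * (G.minDegree : ℝ) * ((Fintype.card V : ℝ) - k - 2) * ((k : ℝ) + 2))) :
    ZagrebTraceable.IsTraceable G ∨
      Nonempty (G ≃g completeBipartiteGraph (Fin k) (Fin (k + 2))) := by
  refine or_iff_not_imp_left.2 fun hT => ?_
  have hconn := hG.connected hk
  have := hconn.nonempty
  obtain ⟨I, hI, hcard⟩ := hG.exists_isIndepSet_card_eq hT
  have hδ : k ≤ G.minDegree := G.le_minDegree_of_forall_le_degree k hG.le_degree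
  have hne : I.Nonempty := Finset.card_pos.1 (by omega)
  have hext : ZagrebTraceable.IsExtremal G I := by
    refine ZagrebTraceable.isExtremal_of_le_firstZagreb hI hne (hk.trans hδ) ?_
    have hV : (Fintype.card V : ℝ) = k + 2 + Iᶜ.card := by
      exact_mod_cast hcard ▸ (Finset.card_add_card_compl I).symm
    refine le_of_eq_of_le ?_ hM
    rw [hV, hcard]
    push_cast
    ring
  obtain hN | hΔ := hext.minDegree_eq_card_compl_or_maxDegree_eq_two hk hcard hδ
  · exact (hext.isTraceable_or_nonempty_iso hcard hδ hN
      (Finset.card_pos.1 (by omega))).resolve_left hT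
  · obtain ⟨v, hv⟩ := ZagrebTraceable.exists_three_le_degree_of_not_isTraceable hconn hT
    have hle := G.degree_le_maxDegree v
    omega

theorem theorem2 {V : Type*} [Fintype V] [DecidableEq V] (G : SimpleGraph V)
    [DecidableRel G.Adj] (k : ℕ) (hk : 1 ≤ k) (hn : 9 ≤ Fintype.card V)
    (hG : ZagrebTraceable.IsKConnected G k)
    (hM : (ZagrebTraceable.firstZagreb G : ℝ) ≥
      ((Fintype.card V : ℝ) - k - 2) * (G.maxDegree : ℝ) ^ 2 +
        ((G.edgeFinset.card : ℝ) * ((G.minDegree : ℝ) + (Fintype.card V : ℝ) - k - 2)) ^ 2 /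
          (4 * (G.minDegree : ℝ) * ((Fintype.card V : ℝ) - k - 2) * ((k : ℝ) + 2))) :
    ZagrebTraceable.IsTraceable G ∨
      Nonempty (G ≃g completeBipartiteGraph (Fin k) (Fin (k + 2))) :=
  theorem2_general G k hk hG hM
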